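/- Let $\mathfrak X\subseteq\mathcal P(\mathbb N)$ be a Scott set, i.e. a Boolean algebra of subsets of $\mathbb N$ such that (a) if $A\in\mathfrak X$ and $B\subseteq\mathbb N$ is Turing computable from $A$, then $B\in\mathfrak X$; and (b) if $T\subseteq 2^{<\omega}$ is an infinite binary tree coded by a set in $\mathfrak X$, then $\mathfrak X$ contains a set coding an infinite path through $T$. Let $\mathfrak X/\mathrm{Fin}$ be the poset of infinite sets in $\mathfrak X$ ordered by almost inclusion: $A\le B$ iff $A\setminus B$ is finite. A sequence $\langle B_n\mid n\in\mathbb N\rangle$ of subsets of $\mathbb N$ is coded in $\mathfrak X$ if there is $B\in\mathfrak X$ with $B_n=\{m\mid\langle n,m\rangle\in B\}$ for all $n$, where $\langle\cdot,\cdot\rangle$ is a fixed computable pairing function. A set $C\in\mathfrak X/\mathrm{Fin}$ decides such a sequence if for every ultrafilter $U$ on the Boolean algebra $\mathfrak X$ with $C\in U$ we have $\{n\in\mathbb N\mid B_n\in U\}\in\mathfrak X$. Then the following are equivalent: 1. $\mathfrak X$ is arithmetically closed: every $B\subseteq\mathbb N$ that is first-order definable in the structure $\langle\mathbb N,0,1,+,\cdot,<,A\rangle_{A\in\mathfrak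 X}$, with a unary predicate for each $A\in\mathfrak X$, belongs to $\mathfrak X$. 2. $\mathfrak X$ is decisive: for every sequence $\langle B_n\mid n\in\mathbb N\rangle$ coded in $\mathfrak X$, the set of $C\in\mathfrak X/\mathrm{Fin}$ that decide it is dense in $\mathfrak X/\mathrm{Fin}$, i.e. below every $A\in\mathfrak X/\mathrm{Fin}$ there is such a $C$. 3. For every sequence $\langle B_n\mid n\in\mathbb N\rangle$ coded in $\mathfrak X$, there is $C\in\mathfrak X/\mathrm{Fin}$ that decides it. -/

import Mathlib

namespace ScottSets

/-- The characteristic function of `A ⊆ ℕ`, as a (total) element of `ℕ →. ℕ`. -/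
noncomputable def charFn (A : Set ℕ) : ℕ →. ℕ :=
  fun n => Part.some (A.indicator (fun _ => 1) n)

/-- A binary tree: a set of finite binary sequences closed under initial segments. -/
def IsBinaryTree (T : Set (List Bool)) : Prop :=
  ∀ s t : List Bool, s <+: t → t ∈ T → s ∈ T

/-- The set of natural numbers coding a set of finite binary sequences. -/
def treeCode (T : Set (List Bool)) : Set ℕ :=
  Encodable.encode '' T

open Classical in
/-- The initial segment of length `n` of the infinite binary sequence
with characteristic set `P`. -/
noncomputable def restrict (P : Set ℕ) (n : ℕ) : List Bool :=
  (List.range n).map fun i => decide (i ∈ P)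

/-- `P`, viewed as an infinite binary sequence, is a path (cofinal branch) through `T`. -/
def IsPath (T : Set (List Bool)) (P : Set ℕ) : Prop :=
  ∀ n, restrict P n ∈ T

/-- A Scott set: a Boolean algebra of subsets of `ℕ`, closed under Turing reducibility, that
contains a path through every infinite binary tree that it codes. -/
structure IsScottSet (X : Set (Set ℕ)) : Prop where
  isSetAlgebra : MeasureTheory.IsSetAlgebra X
  mem_of_turingReducible : ∀ A ∈ X, ∀ B : Set ℕ, TuringReducible (charFn B) (charFn A) → B ∈ X
  exists_path : ∀ T : Set (List Bool), IsBinaryTree T → T.Infinite → treeCode T ∈ X →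
    ∃ P ∈ X, IsPath T P

/-- Function symbols of the language of arithmetic. -/
inductive ArithFunc : ℕ → Type
  | zero : ArithFunc 0
  | one : ArithFunc 0
  | add : ArithFunc 2
  | mul : ArithFunc 2

/-- Relation symbols: `<`, and a unary predicate for every `A ∈ S`. -/
inductive ArithRel (S : Set (Set ℕ)) : ℕ → Type
  | lt : ArithRel S 2
  | pred (A : S) : ArithRel S 1

/-- The language of arithmetic `{0, 1, +, ·, <}` expanded by unary predicates for all `A ∈ S`. -/
def arithLang (S : Set (Set ℕ)) : FirstOrder.Language where
  Functions := ArithFunc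
  Relations := ArithRel S

/-- The structure `⟨ℕ, A⟩_{A ∈ S}` with its natural interpretation. -/
instance arithStructure (S : Set (Set ℕ)) : (arithLang S).Structure ℕ where
  funMap {_} f :=
    match f with
    | ArithFunc.zero => fun _ => 0
    | ArithFunc.one => fun _ => 1
    | ArithFunc.add => fun v => v 0 + v 1
    | ArithFunc.mul => fun v => v 0 * v 1
  RelMap {_} r :=
    match r with
    | ArithRel.lt => fun v => v 0 < v 1
    | ArithRel.pred A => fun v => v 0 ∈ (A : Set ℕ)

/-- `S` is arithmetically closed: every subset of `ℕ` definable in `⟨ℕ, A⟩_{A ∈ S}` is in `S`.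
(Definability with parameters is the same thing, as every natural number is the value of a
closed term.) -/
def ArithmeticallyClosed (S : Set (Set ℕ)) : Prop :=
  ∀ B : Set ℕ, (∅ : Set ℕ).Definable₁ (arithLang S) B → B ∈ S

/-- The poset `X/Fin`: the infinite sets in `X`. -/
def ModFin (X : Set (Set ℕ)) : Type :=
  {A : Set ℕ // A ∈ X ∧ A.Infinite}

/-- `X/Fin` is ordered by almost inclusion. -/
instance ModFin.instPreorder (X : Set (Set ℕ)) : Preorder (ModFin X) where
  le A B := (A.1 \ B.1).Finite
  le_refl A := by simp
  le_trans A B C hAB hBC := (hAB.union hBC).subset fun x hx => by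
    by_cases h : x ∈ B.1
    · exact Or.inr ⟨h, hx.2⟩
    · exact Or.inl ⟨hx.1, h⟩

/-- `D` is dense in the poset `P`. -/
def IsDenseIn {P : Type} [Preorder P] (D : Set P) : Prop :=
  ∀ a : P, ∃ c ∈ D, c ≤ a

/-- An ultrafilter on the Boolean algebra of sets `X`. -/
structure IsUltrafilterOn (X U : Set (Set ℕ)) : Prop where
  subset : U ⊆ X
  univ_mem : Set.univ ∈ U
  empty_notMem : ∅ ∉ U
  inter_mem : ∀ A ∈ U, ∀ B ∈ U, A ∩ B ∈ U
  mem_of_superset : ∀ A ∈ U, ∀ B ∈ X, A ⊆ B → B ∈ U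
  mem_or_compl_mem : ∀ A ∈ X, A ∈ U ∨ Aᶜ ∈ U

/-- The sequence `⟨B n⟩` is coded in `X`. -/
def CodedIn (X : Set (Set ℕ)) (B : ℕ → Set ℕ) : Prop :=
  ∃ B' ∈ X, ∀ n, B n = {m | Nat.pair n m ∈ B'}

/-- `C ∈ X/Fin` decides the sequence `⟨B n⟩`. -/
def Decides {X : Set (Set ℕ)} (C : ModFin X) (B : ℕ → Set ℕ) : Prop :=
  ∀ U : Set (Set ℕ), IsUltrafilterOn X U → C.1 ∈ U → {n | B n ∈ U} ∈ X

/-- `X` is decisive: for every coded sequence, the conditions deciding it are dense. -/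
def Decisive (X : Set (Set ℕ)) : Prop :=
  ∀ B : ℕ → Set ℕ, CodedIn X B → IsDenseIn {C : ModFin X | Decides C B}

end ScottSets

namespace ScottSets

open Encodable

variable {X : Set (Set ℕ)} {A : Set ℕ}

/-! ### Oracle computations -/

/-! Everything passes through `ProjClosed`. A Scott set is closed under Boolean operations and
relative computability, so closure under one existential quantifier gives closure under all
first-order definitions, by induction on formulas. Conversely, the pairing function is definable, so
arithmetical closure yields projections.

Deciding gives projections (`projClosed_of_exists_decides`): replace the projection of `A` by the
sequence of sets `{m | ∃ k < m, ⟨n, k⟩ ∈ A}`, computable from `A`. Each is empty or cofinite, so a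
nonprincipal ultrafilter contains exactly those with `n` in the projection.

Projections give decisiveness (`ProjClosed.decisive`): the membership patterns realized by
infinitely many elements of `A` form an infinite tree arithmetical in the data. A path `P` in `X`
yields a decreasing sequence of infinite subsets of `A`, and a pseudo-intersection `C` of it.
Nonprincipal ultrafilters containing `C` give `P` as the decided set; principal ones give a set
computable from the sequence. -/

theorem recursiveIn_charFn_comp {f : ℕ → ℕ} (hf : Primrec f) :
    Nat.RecursiveIn {charFn A} (fun n => charFn A (f n)) := by
  have h := Nat.RecursiveIn.comp (.oracle (O := {charFn A}) (charFn A) rfl)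
    (Nat.Primrec.recursiveIn (Primrec.nat_iff.1 hf))
  exact h.of_eq fun n => Part.bind_some (f n) (charFn A)

theorem charFn_preimage (f : ℕ → ℕ) (n : ℕ) : charFn (f ⁻¹' A) n = charFn A (f n) :=
  rfl

theorem turingReducible_preimage {f : ℕ → ℕ} (hf : Primrec f) :
    TuringReducible (charFn (f ⁻¹' A)) (charFn A) :=
  RecursiveIn.iff_nat.2 ((recursiveIn_charFn_comp hf).of_eq fun n => (charFn_preimage f n).symm)

/-- The set of codes of pairs `(n, m)` such that `(n, k)` is coded in `A` for some `k < m`. -/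
def boundedProj (A : Set ℕ) : Set ℕ :=
  {p | ∃ k < p.unpair.2, Nat.pair p.unpair.1 k ∈ A}

/-- The number of `k < m` such that `(n, k)` is coded in `A`. -/
noncomputable def countBelow (A : Set ℕ) (n m : ℕ) : ℕ :=
  ∑ k ∈ Finset.range m, A.indicator (fun _ => 1) (Nat.pair n k)

theorem countBelow_pos_iff {n m : ℕ} : 0 < countBelow A n m ↔ ∃ k < m, Nat.pair n k ∈ A := by
  classical
  simp [countBelow, Nat.pos_iff_ne_zero, Set.indicator_apply]

theorem recursiveIn_countBelow :
    Nat.RecursiveIn {charFn A}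
      (fun p => Part.some (countBelow A p.unpair.1 p.unpair.2)) := by
  have hstep : Nat.RecursiveIn {charFn A} (fun p : ℕ =>
      Part.some (p.unpair.2.unpair.2 +
        A.indicator (fun _ => 1) (Nat.pair p.unpair.1 p.unpair.2.unpair.1))) := by
    have hidx : Primrec fun p : ℕ => Nat.pair p.unpair.1 p.unpair.2.unpair.1 :=
      Primrec₂.natPair.comp (Primrec.fst.comp Primrec.unpair)
        (Primrec.fst.comp (Primrec.unpair.comp (Primrec.snd.comp Primrec.unpair)))
    have hacc : Primrec fun p : ℕ => p.unpair.2.unpair.2 :=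
      Primrec.snd.comp (Primrec.unpair.comp (Primrec.snd.comp Primrec.unpair))
    have hadd : Primrec fun p : ℕ => p.unpair.1 + p.unpair.2 :=
      Primrec.nat_add.comp (Primrec.fst.comp Primrec.unpair) (Primrec.snd.comp Primrec.unpair)
    have h := Nat.RecursiveIn.comp
      (Nat.Primrec.recursiveIn (O := {charFn A}) (Primrec.nat_iff.1 hadd))
      (.pair (Nat.Primrec.recursiveIn (Primrec.nat_iff.1 hacc)) (recursiveIn_charFn_comp hidx))
    exact h.of_eq fun p => by simp [charFn, Seq.seq]
  have h := Nat.RecursiveIn.prec (.zero (O := {charFn A})) hstep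
  refine h.of_eq fun p => ?_
  simp only
  induction p.unpair.2 with
  | zero => simp [countBelow]; rfl
  | succ m ih =>
    refine (congrArg (Part.bind · _) ih).trans ((Part.bind_some _ _).trans ?_)
    simp [countBelow, Finset.sum_range_succ]

theorem turingReducible_boundedProj :
    TuringReducible (charFn (boundedProj A)) (charFn A) := by
  -- With truncated subtraction this is the sign function, which turns the count into a
  -- characteristic value.
  have hsign : Primrec fun n : ℕ => 1 - (1 - n) :=
    Primrec.nat_sub.comp (Primrec.const 1) (Primrec.nat_sub.comp (Primrec.const 1) Primrec.id)
  have h := Nat.RecursiveIn.comp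
    (Nat.Primrec.recursiveIn (O := {charFn A}) (Primrec.nat_iff.1 hsign)) recursiveIn_countBelow
  refine RecursiveIn.iff_nat.2 (h.of_eq fun p => ?_)
  have hp : p ∈ boundedProj A ↔ 0 < countBelow A p.unpair.1 p.unpair.2 :=
    countBelow_pos_iff.symm
  by_cases h0 : p ∈ boundedProj A
  · have := hp.1 h0
    simp [charFn, h0]
    omega
  · have h1 : countBelow A p.unpair.1 p.unpair.2 = 0 := by simpa using mt hp.2 h0
    simp [charFn, h0, h1]

/-! ### Relations whose set of codes belongs to a Scott set -/

namespace IsScottSet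

theorem preimage_mem (hX : IsScottSet X) (hA : A ∈ X) {f : ℕ → ℕ} (hf : Primrec f) :
    f ⁻¹' A ∈ X :=
  hX.mem_of_turingReducible A hA _ (turingReducible_preimage hf)

theorem setOf_primrecPred_mem (hX : IsScottSet X) {p : ℕ → Prop} (hp : PrimrecPred p) :
    {n | p n} ∈ X := by
  classical
  -- Truncated `1 - n` is the characteristic function of `{0}`; the given set is then a preimage of
  -- `{0}`.
  have hz : ({0} : Set ℕ) ∈ X := by
    refine hX.mem_of_turingReducible ∅ hX.isSetAlgebra.empty_mem _ ?_
    refine RecursiveIn.iff_nat.2 ((Nat.Primrec.recursiveIn (Primrec.nat_iff.1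
      (Primrec.nat_sub.comp (Primrec.const 1) Primrec.id))).of_eq fun n => ?_)
    rcases n with _ | n <;> simp [charFn]
  have := hX.preimage_mem hz (Primrec.ite hp (Primrec.const 0) (Primrec.const 1))
  convert this using 1
  ext n
  by_cases h : p n <;> simp [h]

theorem finite_mem (hX : IsScottSet X) {F : Set ℕ} (hF : F.Finite) : F ∈ X := by
  induction F, hF using Set.Finite.induction_on with
  | empty => exact hX.isSetAlgebra.empty_mem
  | @insert a s _ _ ih =>
    rw [Set.insert_eq]
    exact hX.isSetAlgebra.union_mem
      (hX.setOf_primrecPred_mem (Primrec.eq.comp Primrec.id (Primrec.const a))) ih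

end IsScottSet

/-- The set of codes of the elements satisfying `p` belongs to `X`. -/
def InX (X : Set (Set ℕ)) {α : Type} [Primcodable α] (p : α → Prop) : Prop :=
  encode '' {a | p a} ∈ X

namespace InX

variable {α β : Type} [Primcodable α] [Primcodable β] {p q : α → Prop}

theorem nat_iff {p : ℕ → Prop} : InX X p ↔ {n | p n} ∈ X := by
  simp [InX]

theorem of_iff (hp : InX X p) (h : ∀ a, p a ↔ q a) : InX X q := by
  rwa [← funext fun a => propext (h a)]

theorem range_encode_mem (hX : IsScottSet X) (α : Type) [Primcodable α] :
    Set.range (encode : α → ℕ) ∈ X := by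
  -- On options, `none` has code `0` and `some a` has code `encode a + 1`, so this equation holds
  -- exactly when `n` is the code of what it decodes to.
  have h : PrimrecPred fun n : ℕ => encode (decode (α := α) n) = n + 1 :=
    Primrec.eq.comp (Primrec.encode.comp Primrec.decode) Primrec.succ
  convert hX.setOf_primrecPred_mem h using 1
  ext n
  constructor
  · rintro ⟨a, rfl⟩
    simp
  · intro hn
    cases hd : decode (α := α) n with
    | none => simp [hd] at hn
    | some a => exact ⟨a, by simpa [hd] using hn⟩

theorem comp (hX : IsScottSet X) (hp : InX X p) {f : β → α} (hf : Primrec f) :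
    InX X fun b => p (f b) := by
  have hg : Primrec fun n : ℕ => encode ((decode (α := β) n).map f) :=
    Primrec.encode.comp (Primrec.option_map Primrec.decode (hf.comp Primrec.snd).to₂)
  -- `Nat.pred` undoes the shift in the code of `some`; `0`, the code of `none`, must be removed.
  have hp' : Nat.pred ⁻¹' (encode '' {a | p a}) ∩ {0}ᶜ ∈ X :=
    hX.isSetAlgebra.inter_mem (hX.preimage_mem hp Primrec.pred)
      (hX.isSetAlgebra.compl_mem (hX.finite_mem (Set.finite_singleton 0)))
  have h := hX.isSetAlgebra.inter_mem (range_encode_mem hX β) (hX.preimage_mem hp' hg)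
  unfold InX
  convert h using 1
  ext n
  constructor
  · rintro ⟨b, hb, rfl⟩
    exact ⟨⟨b, rfl⟩, by simpa using hb⟩
  · rintro ⟨⟨b, rfl⟩, hb⟩
    exact ⟨b, by simpa using hb, rfl⟩

theorem mem (hX : IsScottSet X) (hA : A ∈ X) {f : α → ℕ} (hf : Primrec f) :
    InX X fun a => f a ∈ A :=
  (nat_iff.2 hA : InX X fun n => n ∈ A).comp hX hf

theorem not (hX : IsScottSet X) (hp : InX X p) : InX X fun a => ¬ p a := by
  have h := hX.isSetAlgebra.inter_mem (range_encode_mem hX α) (hX.isSetAlgebra.compl_mem hp)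
  unfold InX
  convert h using 1
  ext n
  constructor
  · rintro ⟨b, hb, rfl⟩
    exact ⟨⟨b, rfl⟩, by simpa using hb⟩
  · rintro ⟨⟨b, rfl⟩, hb⟩
    exact ⟨b, by simpa using hb, rfl⟩

theorem or (hX : IsScottSet X) (hp : InX X p) (hq : InX X q) : InX X fun a => p a ∨ q a := by
  unfold InX
  rw [show {a | p a ∨ q a} = {a | p a} ∪ {a | q a} from rfl, Set.image_union]
  exact hX.isSetAlgebra.union_mem hp hq

theorem and (hX : IsScottSet X) (hp : InX X p) (hq : InX X q) : InX X fun a => p a ∧ q a :=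
  (((hp.not hX).or hX (hq.not hX)).not hX).of_iff fun a => by tauto

theorem imp (hX : IsScottSet X) (hp : InX X p) (hq : InX X q) : InX X fun a => p a → q a :=
  ((hp.not hX).or hX hq).of_iff fun a => by tauto

theorem iff (hX : IsScottSet X) (hp : InX X p) (hq : InX X q) : InX X fun a => (p a ↔ q a) :=
  ((hp.imp hX hq).and hX (hq.imp hX hp)).of_iff fun a => by tauto

theorem of_primrecPred (hX : IsScottSet X) (hp : PrimrecPred p) : InX X p := by
  classical
  have hf : Primrec fun a => if p a then 1 else 0 :=
    Primrec.ite hp (Primrec.const 1) (Primrec.const 0)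
  exact (mem hX (hX.finite_mem (Set.finite_singleton 1)) hf).of_iff fun a => by
    by_cases h : p a <;> simp [h]

end InX

/-- `X` is closed under projections along the second coordinate. -/
def ProjClosed (X : Set (Set ℕ)) : Prop :=
  ∀ A ∈ X, {n | ∃ m, Nat.pair n m ∈ A} ∈ X

namespace InX

variable {α β : Type} [Primcodable α] [Primcodable β] {p : α × β → Prop}

theorem ex (hproj : ProjClosed X) (hp : InX X p) : InX X fun a => ∃ b, p (a, b) := by
  have h := hproj _ hp
  unfold InX
  convert h using 1
  ext n
  constructor
  · rintro ⟨a, ⟨b, hb⟩, rfl⟩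
    exact ⟨encode b, (a, b), hb, rfl⟩
  · rintro ⟨m, ⟨a, b⟩, hb, h⟩
    obtain ⟨rfl, -⟩ := Nat.pair_eq_pair.1 h
    exact ⟨a, ⟨b, hb⟩, rfl⟩

theorem all (hX : IsScottSet X) (hproj : ProjClosed X) (hp : InX X p) :
    InX X fun a => ∀ b, p (a, b) :=
  (((hp.not hX).ex hproj).not hX).of_iff fun a => by simp

end InX

/-! ### Arithmetical closure and closure under projections -/

open FirstOrder FirstOrder.Language

/-- The free variable stored in a code of an environment with `n` bound variables. -/
def envFree : ℕ → ℕ → ℕ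
  | 0, c => c
  | n + 1, c => envFree n c.unpair.1

/-- The bound variables stored in a code of an environment. -/
def envBound : (n : ℕ) → ℕ → Fin n → ℕ
  | 0, _ => Fin.elim0
  | n + 1, c => Fin.snoc (envBound n c.unpair.1) c.unpair.2

theorem primrec_envFree (n : ℕ) : Primrec (envFree n) := by
  induction n with
  | zero => exact Primrec.id
  | succ n ih => exact ih.comp (Primrec.fst.comp Primrec.unpair)

theorem primrec_envBound (n : ℕ) (i : Fin n) : Primrec fun c => envBound n c i := by
  induction n with
  | zero => exact i.elim0
  | succ n ih =>
    induction i using Fin.lastCases with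
    | last => simpa [envBound] using Primrec.snd.comp Primrec.unpair
    | cast i => simpa [envBound] using (ih i).comp (Primrec.fst.comp Primrec.unpair)

theorem primrec_realize {n : ℕ} (t : (arithLang X).Term (Fin 1 ⊕ Fin n)) :
    Primrec fun c => t.realize (Sum.elim (fun _ => envFree n c) (envBound n c)) := by
  induction t with
  | var i =>
    rcases i with i | i
    · simpa using primrec_envFree n
    · simpa using primrec_envBound n i
  | func f ts ih =>
    cases f with
    | zero => exact Primrec.const 0
    | one => exact Primrec.const 1
    | add => exact Primrec.nat_add.comp (ih 0) (ih 1)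
    | mul => exact Primrec.nat_mul.comp (ih 0) (ih 1)

/-- Coding the whole environment by one number makes adding a bound variable a pairing, so the
quantifier case is closure under projections. -/
theorem setOf_realize_mem (hX : IsScottSet X) (hproj : ProjClosed X) {n : ℕ}
    (φ : (arithLang X).BoundedFormula (Fin 1) n) :
    InX X fun c : ℕ => φ.Realize (fun _ => envFree n c) (envBound n c) := by
  induction φ with
  | falsum => exact InX.nat_iff.2 hX.isSetAlgebra.empty_mem
  | equal s t =>
    exact InX.of_primrecPred hX (Primrec.eq.comp (primrec_realize s) (primrec_realize t))
  | rel R ts =>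
    cases R with
    | lt =>
      exact InX.of_primrecPred hX
        (Primrec.nat_lt.comp (primrec_realize (ts 0)) (primrec_realize (ts 1)))
    | pred A => exact InX.mem hX A.2 (primrec_realize (ts 0))
  | imp _ _ ih₁ ih₂ => exact ih₁.imp hX ih₂
  | all φ ih =>
    have h := (ih.comp hX (f := fun q : ℕ × ℕ => Nat.pair q.1 q.2)
      (Primrec₂.natPair.comp Primrec.fst Primrec.snd)).all hX hproj
    exact h.of_iff fun c => by simp [envFree, envBound]

theorem ProjClosed.arithmeticallyClosed (hX : IsScottSet X) (hproj : ProjClosed X) :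
    ArithmeticallyClosed X := by
  intro B hB
  obtain ⟨φ, hφ⟩ := Set.empty_definable_iff.1 hB
  have h := InX.nat_iff.1 (setOf_realize_mem hX hproj φ)
  convert h using 1
  ext n
  have hn : n ∈ B ↔ φ.Realize (fun _ => n) := Set.ext_iff.1 hφ fun _ => n
  rw [hn, Formula.Realize]
  exact iff_of_eq (congrArg (BoundedFormula.Realize φ fun _ => n)
    (Subsingleton.elim _ (envBound 0 n)))

/-- The formula `∃ m, ⟨x, m⟩ ∈ A`, with the pairing function written out. -/
def projFormula (A : X) : (arithLang X).Formula (Fin 1) :=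
  let x : (arithLang X).Term (Fin 1 ⊕ Fin 1) := Term.var (Sum.inl 0)
  let m : (arithLang X).Term (Fin 1 ⊕ Fin 1) := Term.var (Sum.inr 0)
  let add (s t : (arithLang X).Term (Fin 1 ⊕ Fin 1)) : (arithLang X).Term (Fin 1 ⊕ Fin 1) :=
    Term.func (L := arithLang X) ArithFunc.add ![s, t]
  let mul (s t : (arithLang X).Term (Fin 1 ⊕ Fin 1)) : (arithLang X).Term (Fin 1 ⊕ Fin 1) :=
    Term.func (L := arithLang X) ArithFunc.mul ![s, t]
  let lt : (arithLang X).BoundedFormula (Fin 1) 1 :=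
    BoundedFormula.rel (L := arithLang X) ArithRel.lt ![x, m]
  let pred (t : (arithLang X).Term (Fin 1 ⊕ Fin 1)) : (arithLang X).BoundedFormula (Fin 1) 1 :=
    BoundedFormula.rel (L := arithLang X) (ArithRel.pred A) ![t]
  BoundedFormula.ex
    ((lt ⊓ pred (add (mul m m) x)) ⊔ (lt.not ⊓ pred (add (add (mul x x) x) m)))

theorem realize_projFormula (A : X) (v : Fin 1 → ℕ) :
    (projFormula A).Realize v ↔ ∃ m, Nat.pair (v 0) m ∈ A.1 := by
  simp only [projFormula, Formula.Realize, BoundedFormula.realize_ex, BoundedFormula.realize_sup,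
    BoundedFormula.realize_inf, BoundedFormula.realize_not, Nat.pair]
  refine exists_congr fun m => ?_
  change (v 0 < m ∧ m * m + v 0 ∈ A.1) ∨ (¬ v 0 < m ∧ v 0 * v 0 + v 0 + m ∈ A.1) ↔ _
  by_cases h : v 0 < m <;> simp [h]

theorem ArithmeticallyClosed.projClosed (h : ArithmeticallyClosed X) : ProjClosed X := by
  intro A hA
  refine h _ (Set.empty_definable_iff.2 ⟨projFormula ⟨A, hA⟩, ?_⟩)
  ext v
  exact (realize_projFormula ⟨A, hA⟩ v).symm

/-! ### Deciding sequences yields closure under projections -/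

theorem isUltrafilterOn_inter (hX : IsScottSet X) (U : Ultrafilter ℕ) :
    IsUltrafilterOn X {A | A ∈ X ∧ A ∈ U} where
  subset _ hA := hA.1
  univ_mem := ⟨hX.isSetAlgebra.univ_mem, Filter.univ_mem⟩
  empty_notMem h := U.empty_notMem h.2
  inter_mem _ hA _ hB := ⟨hX.isSetAlgebra.inter_mem hA.1 hB.1, Filter.inter_mem hA.2 hB.2⟩
  mem_of_superset _ hA _ hB hAB := ⟨hB, Filter.mem_of_superset hA.2 hAB⟩
  mem_or_compl_mem A hA := (U.mem_or_compl_mem A).imp (fun h => ⟨hA, h⟩)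
    fun h => ⟨hX.isSetAlgebra.compl_mem hA, h⟩

theorem exists_ultrafilter_of_infinite {C : Set ℕ} (hC : C.Infinite) :
    ∃ U : Ultrafilter ℕ, C ∈ U ∧ (U : Filter ℕ) ≤ Filter.cofinite := by
  have : (Filter.cofinite ⊓ Filter.principal C).NeBot := hC.cofinite_inf_principal_neBot
  obtain ⟨U, hU⟩ := Ultrafilter.exists_le (Filter.cofinite ⊓ Filter.principal C)
  exact ⟨U, Filter.le_principal_iff.1 (hU.trans inf_le_right), hU.trans inf_le_left⟩

theorem projClosed_of_exists_decides (hX : IsScottSet X)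
    (h : ∀ B : ℕ → Set ℕ, CodedIn X B → ∃ C : ModFin X, Decides C B) : ProjClosed X := by
  intro A hA
  have hB : boundedProj A ∈ X := hX.mem_of_turingReducible A hA _ turingReducible_boundedProj
  obtain ⟨C, hC⟩ := h (fun n => {m | Nat.pair n m ∈ boundedProj A}) ⟨_, hB, fun _ => rfl⟩
  obtain ⟨U, hCU, hU⟩ := exists_ultrafilter_of_infinite C.2.2
  convert hC _ (isUltrafilterOn_inter hX U) ⟨C.2.1, hCU⟩ using 1
  ext n
  constructor
  · rintro ⟨m, hm⟩
    -- A witness `m` puts every `k > m` into the `n`-th set, which is therefore cofinite.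
    refine ⟨hX.preimage_mem hB (Primrec₂.natPair.comp (Primrec.const n) Primrec.id), hU ?_⟩
    rw [Nat.cofinite_eq_atTop]
    filter_upwards [Filter.eventually_gt_atTop m] with k hk
    exact ⟨m, by simpa using hk, by simpa using hm⟩
  · rintro ⟨-, hn⟩
    obtain ⟨_, k, -, hk⟩ := U.nonempty_of_mem hn
    exact ⟨k, by simpa using hk⟩

/-! ### Closure under projections yields decisiveness -/

theorem IsUltrafilterOn.mem_iff_of_singleton_mem {U : Set (Set ℕ)} (hU : IsUltrafilterOn X U)
    {m : ℕ} (hm : {m} ∈ U) {B : Set ℕ} (hB : B ∈ X) : B ∈ U ↔ m ∈ B := by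
  constructor
  · intro h
    by_contra hmB
    refine hU.empty_notMem ?_
    rw [← Set.singleton_inter_eq_empty.2 hmB]
    exact hU.inter_mem _ hm _ h
  · intro h
    exact hU.mem_of_superset _ hm _ hB (by simpa using h)

theorem IsUltrafilterOn.compl_mem_of_finite (hX : IsScottSet X) {U : Set (Set ℕ)}
    (hU : IsUltrafilterOn X U) (hfree : ∀ m, {m} ∉ U) {F : Set ℕ} (hF : F.Finite) : Fᶜ ∈ U := by
  induction F, hF using Set.Finite.induction_on with
  | empty => simpa using hU.univ_mem
  | @insert a s _ _ ih =>
    rw [Set.insert_eq, Set.compl_union]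
    exact hU.inter_mem _ ((hU.mem_or_compl_mem _
      (hX.finite_mem (Set.finite_singleton a))).resolve_left (hfree a)) _ ih

theorem IsUltrafilterOn.mem_of_almost_subset (hX : IsScottSet X) {U : Set (Set ℕ)}
    (hU : IsUltrafilterOn X U) (hfree : ∀ m, {m} ∉ U) {C B : Set ℕ} (hC : C ∈ U) (hB : B ∈ X)
    (hCB : (C \ B).Finite) : B ∈ U := by
  refine hU.mem_of_superset _
    (hU.inter_mem _ hC _ (hU.compl_mem_of_finite hX hfree hCB)) _ hB ?_
  rintro m ⟨hm, hm'⟩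
  by_contra h
  exact hm' ⟨hm, h⟩

/-- The elements of `A` that agree with the membership pattern `σ` on the sequence coded by
`B`. -/
def agreeing (A B : Set ℕ) (σ : List Bool) : Set ℕ :=
  {m | m ∈ A ∧ ∀ i < σ.length, (Nat.pair i m ∈ B ↔ σ.getD i false = true)}

theorem agreeing_anti (A B : Set ℕ) {σ τ : List Bool} (h : σ <+: τ) :
    agreeing A B τ ⊆ agreeing A B σ := by
  rintro m ⟨hm, hτ⟩
  refine ⟨hm, fun i hi => ?_⟩
  rw [hτ i (hi.trans_le h.length_le)]
  obtain ⟨ρ, rfl⟩ := h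
  rw [List.getD_append _ _ _ _ hi]

theorem agreeing_subset_union (A B : Set ℕ) (σ : List Bool) :
    agreeing A B σ ⊆ agreeing A B (σ ++ [true]) ∪ agreeing A B (σ ++ [false]) := by
  rintro m ⟨hm, hσ⟩
  have key : ∀ b : Bool, (Nat.pair σ.length m ∈ B ↔ b = true) → m ∈ agreeing A B (σ ++ [b]) := by
    refine fun b hb => ⟨hm, fun i hi => ?_⟩
    rw [List.length_append, List.length_singleton, Nat.lt_succ_iff] at hi
    rcases hi.lt_or_eq with hi | rfl
    · rw [List.getD_append _ _ _ _ hi]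
      exact hσ i hi
    · simpa using hb
  by_cases h : Nat.pair σ.length m ∈ B
  · exact Or.inl (key true (by simpa using h))
  · exact Or.inr (key false (by simpa using h))

/-- Pigeonhole: one of the two one-bit extensions of a pattern met infinitely often is again met
infinitely often. -/
theorem exists_agreeing_infinite {A : Set ℕ} (hA : A.Infinite) (B : Set ℕ) (n : ℕ) :
    ∃ σ : List Bool, σ.length = n ∧ (agreeing A B σ).Infinite := by
  induction n with
  | zero => exact ⟨[], rfl, by simpa [agreeing] using hA⟩
  | succ n ih =>
    obtain ⟨σ, rfl, hσ⟩ := ih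
    rcases Set.infinite_union.1 (hσ.mono (agreeing_subset_union A B σ)) with h | h
    · exact ⟨_, by simp, h⟩
    · exact ⟨_, by simp, h⟩

/-- The tree of membership patterns that are met by infinitely many elements of `A`. -/
def patternTree (A B : Set ℕ) : Set (List Bool) :=
  {σ | (agreeing A B σ).Infinite}

theorem isBinaryTree_patternTree (A B : Set ℕ) : IsBinaryTree (patternTree A B) :=
  fun _ _ h ht => Set.Infinite.mono (agreeing_anti A B h) ht

theorem patternTree_infinite {A : Set ℕ} (hA : A.Infinite) (B : Set ℕ) :
    (patternTree A B).Infinite := by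
  refine Set.Infinite.of_image List.length ?_
  convert Set.infinite_univ (α := ℕ)
  refine Set.eq_univ_of_forall fun n => ?_
  obtain ⟨σ, hn, hσ⟩ := exists_agreeing_infinite hA B n
  exact ⟨σ, hσ, hn⟩

theorem inX_mem_agreeing (hX : IsScottSet X) (hproj : ProjClosed X) {A B : Set ℕ} (hA : A ∈ X)
    (hB : B ∈ X) : InX X fun q : List Bool × ℕ => q.2 ∈ agreeing A B q.1 := by
  refine (InX.mem hX hA Primrec.snd).and hX ?_
  have hlt : InX X fun r : (List Bool × ℕ) × ℕ => r.2 < r.1.1.length :=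
    InX.of_primrecPred hX (Primrec.nat_lt.comp Primrec.snd
      (Primrec.list_length.comp (Primrec.fst.comp Primrec.fst)))
  have hmem : InX X fun r : (List Bool × ℕ) × ℕ => Nat.pair r.2 r.1.2 ∈ B :=
    InX.mem hX hB (Primrec₂.natPair.comp Primrec.snd (Primrec.snd.comp Primrec.fst))
  have hget : InX X fun r : (List Bool × ℕ) × ℕ => r.1.1.getD r.2 false = true :=
    InX.of_primrecPred hX (Primrec.eq.comp
      ((Primrec.list_getD false).comp (Primrec.fst.comp Primrec.fst) Primrec.snd)
      (Primrec.const true))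
  exact (hlt.imp hX (hmem.iff hX hget)).all hX hproj

/-- Infinitude of a set of numbers is the condition `∀ k, ∃ m > k`, so two quantifiers over a
relation in `X` suffice. -/
theorem treeCode_patternTree_mem (hX : IsScottSet X) (hproj : ProjClosed X) {A B : Set ℕ}
    (hA : A ∈ X) (hB : B ∈ X) : treeCode (patternTree A B) ∈ X := by
  have hlt : InX X fun r : (List Bool × ℕ) × ℕ => r.1.2 < r.2 :=
    InX.of_primrecPred hX (Primrec.nat_lt.comp (Primrec.snd.comp Primrec.fst) Primrec.snd)
  have hmem : InX X fun r : (List Bool × ℕ) × ℕ => r.2 ∈ agreeing A B r.1.1 :=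
    (inX_mem_agreeing hX hproj hA hB).comp hX
      (Primrec.pair (Primrec.fst.comp Primrec.fst) Primrec.snd)
  have h := ((hlt.and hX hmem).ex hproj).all hX hproj
  exact h.of_iff (q := (· ∈ patternTree A B)) fun σ => by
    simp only [patternTree, Set.mem_ofPred_eq, Set.infinite_iff_exists_gt]
    exact forall_congr' fun k => exists_congr fun m => and_comm

/-- The elements of `A` that agree with `P` on the first `n` sets of the sequence coded by `B`. -/
def agreeingBelow (A B P : Set ℕ) (n : ℕ) : Set ℕ :=
  {m | m ∈ A ∧ ∀ i < n, (Nat.pair i m ∈ B ↔ i ∈ P)}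

theorem agreeing_restrict (A B P : Set ℕ) (n : ℕ) :
    agreeing A B (restrict P n) = agreeingBelow A B P n := by
  ext m
  refine and_congr_right fun _ => ?_
  have hlen : (restrict P n).length = n := by simp [restrict]
  rw [hlen]
  refine forall₂_congr fun i hi => ?_
  simp [restrict, List.getD_eq_getElem?_getD, hi]

/-- The set of all `min (E n ∩ [n, ∞))`. -/
def pseudoInter (E : ℕ → Set ℕ) : Set ℕ :=
  {m | ∃ n, n ≤ m ∧ m ∈ E n ∧ ∀ j, n ≤ j → j < m → j ∉ E n}

theorem exists_mem_pseudoInter {E : ℕ → Set ℕ} (hE : ∀ n, (E n).Infinite) (n : ℕ) :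
    ∃ m ∈ pseudoInter E, n ≤ m := by
  classical
  have h : ∃ m, n ≤ m ∧ m ∈ E n := by
    obtain ⟨m, hm, hnm⟩ := (hE n).exists_gt n
    exact ⟨m, hnm.le, hm⟩
  exact ⟨Nat.find h, ⟨n, (Nat.find_spec h).1, (Nat.find_spec h).2,
    fun j hj hjm hjE => Nat.find_min h hjm ⟨hj, hjE⟩⟩, (Nat.find_spec h).1⟩

theorem pseudoInter_infinite {E : ℕ → Set ℕ} (hE : ∀ n, (E n).Infinite) :
    (pseudoInter E).Infinite := by
  refine Set.infinite_of_forall_exists_gt fun n => ?_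
  obtain ⟨m, hm, hnm⟩ := exists_mem_pseudoInter hE (n + 1)
  exact ⟨m, hm, hnm⟩

/-- Minima chosen at stages `n ≥ k` lie in `E n ⊆ E k`, and each of the finitely many earlier stages
contributes at most one point. -/
theorem pseudoInter_diff_finite {E : ℕ → Set ℕ} (hE : Antitone E) (k : ℕ) :
    (pseudoInter E \ E k).Finite := by
  have hsub : pseudoInter E \ E k ⊆
      ⋃ n ∈ Set.Iio k, {m | n ≤ m ∧ m ∈ E n ∧ ∀ j, n ≤ j → j < m → j ∉ E n} := by
    rintro m ⟨⟨n, hn⟩, hmk⟩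
    refine Set.mem_biUnion (x := n) ?_ hn
    by_contra hnk
    exact hmk (hE (not_lt.1 hnk) hn.2.1)
  refine ((Set.finite_Iio k).biUnion fun n _ => Set.Subsingleton.finite ?_).subset hsub
  rintro a ⟨ha, haE, hamin⟩ b ⟨hb, hbE, hbmin⟩
  rcases lt_trichotomy a b with h | h | h
  · exact absurd haE (hbmin a ha h)
  · exact h
  · exact absurd hbE (hamin b hb h)

theorem pseudoInter_mem (hX : IsScottSet X) (hproj : ProjClosed X) {E : ℕ → Set ℕ}
    (hE : InX X fun q : ℕ × ℕ => q.2 ∈ E q.1) : pseudoInter E ∈ X := by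
  have hle : InX X fun q : ℕ × ℕ => q.2 ≤ q.1 :=
    InX.of_primrecPred hX (Primrec.nat_le.comp Primrec.snd Primrec.fst)
  have hmem : InX X fun q : ℕ × ℕ => q.1 ∈ E q.2 :=
    hE.comp hX (Primrec.pair Primrec.snd Primrec.fst)
  have hle' : InX X fun r : (ℕ × ℕ) × ℕ => r.1.2 ≤ r.2 :=
    InX.of_primrecPred hX (Primrec.nat_le.comp (Primrec.snd.comp Primrec.fst) Primrec.snd)
  have hlt : InX X fun r : (ℕ × ℕ) × ℕ => r.2 < r.1.1 :=
    InX.of_primrecPred hX (Primrec.nat_lt.comp Primrec.snd (Primrec.fst.comp Primrec.fst))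
  have hmem' : InX X fun r : (ℕ × ℕ) × ℕ => r.2 ∈ E r.1.2 :=
    hE.comp hX (Primrec.pair (Primrec.snd.comp Primrec.fst) Primrec.snd)
  have hmin := (hle'.imp hX (hlt.imp hX (hmem'.not hX))).all hX hproj
  exact InX.nat_iff.1 ((hle.and hX (hmem.and hX hmin)).ex hproj)

theorem agreeingBelow_antitone (A B P : Set ℕ) : Antitone (agreeingBelow A B P) :=
  fun _ _ h _ hm => ⟨hm.1, fun i hi => hm.2 i (hi.trans_le h)⟩

theorem inX_mem_agreeingBelow (hX : IsScottSet X) (hproj : ProjClosed X) {A B P : Set ℕ}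
    (hA : A ∈ X) (hB : B ∈ X) (hP : P ∈ X) :
    InX X fun q : ℕ × ℕ => q.2 ∈ agreeingBelow A B P q.1 := by
  refine (InX.mem hX hA Primrec.snd).and hX ?_
  have hlt : InX X fun r : (ℕ × ℕ) × ℕ => r.2 < r.1.1 :=
    InX.of_primrecPred hX (Primrec.nat_lt.comp Primrec.snd (Primrec.fst.comp Primrec.fst))
  have hmem : InX X fun r : (ℕ × ℕ) × ℕ => Nat.pair r.2 r.1.2 ∈ B :=
    InX.mem hX hB (Primrec₂.natPair.comp Primrec.snd (Primrec.snd.comp Primrec.fst))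
  exact (hlt.imp hX (hmem.iff hX (InX.mem hX hP Primrec.snd))).all hX hproj

theorem ProjClosed.decisive (hX : IsScottSet X) (hproj : ProjClosed X) : Decisive X := by
  rintro B ⟨B', hB', hB⟩ ⟨A, hA, hAinf⟩
  obtain rfl : B = fun n => {m | Nat.pair n m ∈ B'} := funext hB
  obtain ⟨P, hP, hpath⟩ := hX.exists_path _ (isBinaryTree_patternTree A B')
    (patternTree_infinite hAinf B') (treeCode_patternTree_mem hX hproj hA hB')
  have hE : ∀ n, (agreeingBelow A B' P n).Infinite := fun n => by
    rw [← agreeing_restrict]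
    exact hpath n
  have hBX : ∀ n, {m | Nat.pair n m ∈ B'} ∈ X := fun n =>
    hX.preimage_mem hB' (Primrec₂.natPair.comp (Primrec.const n) Primrec.id)
  have hfin := pseudoInter_diff_finite (agreeingBelow_antitone A B' P)
  refine ⟨⟨pseudoInter (agreeingBelow A B' P),
    pseudoInter_mem hX hproj (inX_mem_agreeingBelow hX hproj hA hB' hP),
    pseudoInter_infinite hE⟩, fun U hU hCU => ?_,
    (hfin 0).subset (Set.sdiff_subset_sdiff_right fun _ hm => hm.1)⟩
  by_cases hfree : ∀ m, {m} ∉ U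
  -- For nonprincipal `U`, almost inclusion of `C` in stage `n + 1`, the first to fix membership in
  -- the `n`-th set, forces that set or its complement into `U` as `P` dictates.
  · convert hP
    ext n
    by_cases hn : n ∈ P
    · refine iff_of_true (hU.mem_of_almost_subset hX hfree hCU (hBX n) ?_) hn
      exact (hfin (n + 1)).subset
        (Set.sdiff_subset_sdiff_right fun _ hm => (hm.2 n n.lt_succ_self).2 hn)
    · refine iff_of_false (fun hnU => hU.empty_notMem ?_) hn
      have hcompl : {m | Nat.pair n m ∈ B'}ᶜ ∈ U :=
        hU.mem_of_almost_subset hX hfree hCU (hX.isSetAlgebra.compl_mem (hBX n))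
          ((hfin (n + 1)).subset (Set.sdiff_subset_sdiff_right
            fun _ hm h => hn ((hm.2 n n.lt_succ_self).1 h)))
      rw [← Set.inter_compl_self {m | Nat.pair n m ∈ B'}]
      exact hU.inter_mem _ hnU _ hcompl
  -- If `U` is principal at `m`, the decided set is `{n | ⟨n, m⟩ ∈ B'}`, a computable preimage of
  -- `B'`.
  · push Not at hfree
    obtain ⟨m, hm⟩ := hfree
    convert hX.preimage_mem hB' (Primrec₂.natPair.comp Primrec.id (Primrec.const m)) using 1
    ext n
    exact hU.mem_iff_of_singleton_mem hm (hBX n)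

theorem Decisive.exists_decides (hX : IsScottSet X) (h : Decisive X) (B : ℕ → Set ℕ)
    (hB : CodedIn X B) : ∃ C : ModFin X, Decides C B :=
  let ⟨C, hC, _⟩ := h B hB ⟨Set.univ, hX.isSetAlgebra.univ_mem, Set.infinite_univ⟩
  ⟨C, hC⟩

end ScottSets

theorem mainTheorem5 (X : Set (Set ℕ)) (hX : ScottSets.IsScottSet X) :
    List.TFAE [
      ScottSets.ArithmeticallyClosed X,
      ScottSets.Decisive X,
      ∀ B : ℕ → Set ℕ, ScottSets.CodedIn X B →
        ∃ C : ScottSets.ModFin X, ScottSets.Decides C B] := by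
  tfae_have 1 → 2 := fun h => h.projClosed.decisive hX
  tfae_have 2 → 3 := fun h => h.exists_decides hX
  tfae_have 3 → 1 := fun h =>
    (ScottSets.projClosed_of_exists_decides hX h).arithmeticallyClosed hX
  tfae_finish
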